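/- Let $k\ge 3$ and $E_k=\{0,\dots,k-1\}$. A clone on $E_k$ is a set of operations $E_k^n\to E_k$ ($n\ge 1$) that contains all projections and is closed under composition; for a set $R$ of finitary relations on $E_k$, $\mathrm{Pol}\,R$ is the clone of all operations that preserve every relation in $R$, and $\mathrm{Pol}\,\rho=\mathrm{Pol}\{\rho\}$. A clone $\mathcal C$ is maximal below a clone $\mathcal D$ if $\mathcal C\subsetneq\mathcal D$ and there is no clone strictly between them. An $h$-ary relation $\rho\subseteq E_k^h$ ($h\ge 1$) is central if it contains every tuple with two equal entries at different positions, is invariant under all permutations of its coordinates, and its center $C_\rho=\{a\in E_k : (a,a_2,\dots,a_h)\in\rho \text{ for all } a_2,\dots,a_h\in E_k\}$ is nonempty and different from $E_k$. (Thus a unary central relation is a nonempty proper subset of $E_k$.) A $\rho$-chain is a set $B\subseteq E_k$ with $B^h\subseteq\rho$; it is maximal if it is not properly contained in another $\rho$-chain. **Theorem.** Let $k\ge 3$, let $\rho$ be an $h$-ary central relation on $E_k$ with $h\ge 2$, and let $\sigma\ne\rho$ be an $s$-ary central relation on $E_k$ with $s\ge 1$. Then $\mathrm{Pol}\{\rho,\sigma\}$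 is maximal below $\mathrm{Pol}\,\rho$ if and only if at least one of the following five conditions holds: (I) $s=1$ and $C_\rho\cap\sigma\ne\emptyset$; (II) $s=1$, $h=2$, $\rho=\{(a,b)\in E_k^2 : \exists u\in\sigma,\ (a,u)\in\rho \text{ and } (b,u)\in\rho\}$, and $B\cap\sigma\neq\emptyset$ for every maximal $\rho$-chain $B$; (III) $s=h$, and either $\rho\subsetneq\sigma$ or $\sigma\subsetneq\rho$; (IV) $2\le s<h$ and $C_\rho\cap C_\sigma\ne\emptyset$; (V) $2\le h<s$ and $\{(a_1,\dots,a_s)\in E_k^s : (a_1,\dots,a_h)\in\rho\}\subsetneq\sigma$. -/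

import Mathlib

namespace CloneTheory

/-- A clone on `A`: a set of finitary operations of arities `n ≥ 1` (sorted by arity) that
contains the projections and is closed under composition. -/
@[ext]
structure OpClone (A : Type*) where
  /-- the `n`-ary operations of the clone -/
  ops : ∀ n : ℕ, Set ((Fin n → A) → A)
  ops_zero : ops 0 = ∅
  proj_mem : ∀ (n : ℕ) (i : Fin n), (fun x : Fin n → A => x i) ∈ ops n
  comp_mem : ∀ (m n : ℕ) (g : (Fin m → A) → A) (f : Fin m → (Fin n → A) → A),
    g ∈ ops m → (∀ i, f i ∈ ops n) → (fun x : Fin n → A => g (fun i => f i x)) ∈ ops n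

/-- Clones are ordered by inclusion. -/
instance OpClone.instPartialOrder (A : Type*) : PartialOrder (OpClone A) :=
  PartialOrder.lift OpClone.ops (fun _ _ h => OpClone.ext h)

/-- The operation `f` preserves the relation `ρ`: applying `f` coordinatewise to tuples
`a 0, …, a (n - 1)` of `ρ` gives a tuple of `ρ`. -/
def Preserves {A : Type*} {n h : ℕ} (f : (Fin n → A) → A) (ρ : Set (Fin h → A)) : Prop :=
  ∀ a : Fin n → Fin h → A, (∀ j, a j ∈ ρ) → (fun i : Fin h => f (fun j => a j i)) ∈ ρ

/-- Finitary relations on `A`, bundled with their arity. -/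
abbrev FinRel (A : Type*) : Type _ := Σ h : ℕ, Set (Fin h → A)

/-- `Pol R`: the clone of all operations (of arity at least one) preserving every relation
in `R`. -/
def Pol {A : Type*} (R : Set (FinRel A)) : OpClone A where
  ops n := {f | 0 < n ∧ ∀ r ∈ R, Preserves f r.2}
  ops_zero := by
    ext f
    simp
  proj_mem n i := ⟨Nat.lt_of_le_of_lt (Nat.zero_le _) i.isLt, fun _ _ _ ha => ha i⟩
  comp_mem m n g f hg hf :=
    ⟨(hf ⟨0, hg.1⟩).1, fun r hr a ha => hg.2 r hr _ (fun i => (hf i).2 r hr a ha)⟩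

/-- `ρ` contains every tuple with two equal entries at different positions. -/
def TotallyReflexive {A : Type*} {h : ℕ} (ρ : Set (Fin h → A)) : Prop :=
  ∀ x : Fin h → A, (∃ i j : Fin h, i ≠ j ∧ x i = x j) → x ∈ ρ

/-- `ρ` is invariant under every permutation of its coordinates. -/
def TotallySymmetric {A : Type*} {h : ℕ} (ρ : Set (Fin h → A)) : Prop :=
  ∀ π : Equiv.Perm (Fin h), ∀ x ∈ ρ, (fun i => x (π i)) ∈ ρ

/-- The center of `ρ`: all `a` such that every tuple whose first entry is `a` lies in `ρ`. -/
def center {A : Type*} {h : ℕ} (ρ : Set (Fin h → A)) : Set A :=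
  {a | ∀ x : Fin h → A, (∃ i : Fin h, (i : ℕ) = 0 ∧ x i = a) → x ∈ ρ}

/-- Central relations. -/
structure IsCentral {A : Type*} {h : ℕ} (ρ : Set (Fin h → A)) : Prop where
  arity_pos : 1 ≤ h
  totallyReflexive : TotallyReflexive ρ
  totallySymmetric : TotallySymmetric ρ
  center_nonempty : (center ρ).Nonempty
  center_ne_univ : center ρ ≠ Set.univ

/-- Transport of a relation along an equality of arities. -/
def castArity {A : Type*} {h h' : ℕ} (e : h = h') (ρ : Set (Fin h → A)) :
    Set (Fin h' → A) :=
  {x | (fun i : Fin h => x (Fin.cast e i)) ∈ ρ}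

/-- A unary relation viewed as a subset of `A`. -/
def unarySet {A : Type*} (σ : Set (Fin 1 → A)) : Set A :=
  {u | ![u] ∈ σ}

/-- The pairs `(a, b)` with a common `ρ`-neighbour in the unary relation `σ`. -/
def commonNeighbour {A : Type*} (ρ : Set (Fin 2 → A)) (σ : Set (Fin 1 → A)) :
    Set (Fin 2 → A) :=
  {x | ∃ u ∈ unarySet σ, ![x 0, u] ∈ ρ ∧ ![x 1, u] ∈ ρ}

/-- `B` is a `ρ`-chain: all tuples with entries in `B` lie in `ρ`. -/
def IsRelChain {A : Type*} {h : ℕ} (ρ : Set (Fin h → A)) (B : Set A) : Prop :=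
  ∀ x : Fin h → A, (∀ i, x i ∈ B) → x ∈ ρ

/-- The extension of the `h`-ary relation `ρ` to arity `s ≥ h`: the first `h` entries form
a tuple of `ρ`. -/
def extendArity {A : Type*} {h s : ℕ} (e : h ≤ s) (ρ : Set (Fin h → A)) :
    Set (Fin s → A) :=
  {x | (fun i : Fin h => x (Fin.castLE e i)) ∈ ρ}

/-- Condition (I): `σ` is unary and meets the center of `ρ`. -/
def TypeI {A : Type*} {h s : ℕ} (ρ : Set (Fin h → A)) (σ : Set (Fin s → A)) : Prop :=
  ∃ es : s = 1, (center ρ ∩ unarySet (castArity es σ)).Nonempty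

/-- Condition (II): `σ` is unary, `ρ` is the binary relation of pairs with a common
`ρ`-neighbour in `σ`, and every (inclusion-)maximal `ρ`-chain meets `σ`. -/
def TypeII {A : Type*} {h s : ℕ} (ρ : Set (Fin h → A)) (σ : Set (Fin s → A)) : Prop :=
  ∃ (es : s = 1) (eh : h = 2),
    castArity eh ρ = commonNeighbour (castArity eh ρ) (castArity es σ) ∧
      ∀ B : Set A, Maximal (IsRelChain ρ) B → (B ∩ unarySet (castArity es σ)).Nonempty

/-- Condition (III): `ρ` and `σ` have the same arity and one is strictly contained in the
other. -/
def TypeIII {A : Type*} {h s : ℕ} (ρ : Set (Fin h → A)) (σ : Set (Fin s → A)) : Prop :=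
  ∃ e : s = h, ρ ⊂ castArity e σ ∨ castArity e σ ⊂ ρ

/-- Condition (IV): `2 ≤ s < h` and the centers meet. -/
def TypeIV {A : Type*} {h s : ℕ} (ρ : Set (Fin h → A)) (σ : Set (Fin s → A)) : Prop :=
  2 ≤ s ∧ s < h ∧ (center ρ ∩ center σ).Nonempty

/-- Condition (V): `2 ≤ h < s` and the extension of `ρ` to arity `s` is strictly contained
in `σ`. -/
def TypeV {A : Type*} {h s : ℕ} (ρ : Set (Fin h → A)) (σ : Set (Fin s → A)) : Prop :=
  2 ≤ h ∧ ∃ e : h < s, extendArity e.le ρ ⊂ σ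

end CloneTheory

/-! The basic device: send the rows of a matrix to prescribed values and every other argument to a
central element of `ρ`. The result preserves `ρ` as soon as every injective choice of `h` rows with
all columns in `ρ` has its prescribed values in `ρ` (`IsCentral.preservesOn_extend`).

Sufficiency: let a clone contain `Pol {ρ, σ}` and some `f` in `Pol ρ` violating `σ`. A given `g` in
`Pol ρ` is written as `H` applied to the variables and to further members of the clone. `H` agrees
with `g` on the arguments that actually occur, and elsewhere is altered so that it preserves `σ` too
(`covBy_of_common_center`, `covBy_of_chains`).

Necessity: under maximality, an invariant relation `R` of `Pol {ρ, σ}` is invariant under `Pol ρ` or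
forces `σ` (`preserved_or_of_covBy`). One operation preserving `ρ` and `R` but not `σ` excludes the
latter; then `IsCentral.mem_of_preserved` puts unexpected tuples into `R`. With `R` saying that one
`u` completes whole families of tuples, a family listing all of `A` makes `u` central. This gives
`typeI_of_covBy_of_three_le`, `typeII_of_covBy` and `centers_meet_of_covBy`; intersecting `σ` with
the extension of `ρ` gives `comparable_of_covBy`. -/

namespace CloneTheory

open Function

/-! ### Central relations and operations extended by a central value -/

section Basic

variable {A : Type*} {h s : ℕ}

/-- Preservation for operations and relations with arbitrary index types. -/
def PreservesOn {A N ι : Type*} (f : (N → A) → A) (R : Set (ι → A)) : Prop :=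
  ∀ a : N → ι → A, (∀ j, a j ∈ R) → (fun i => f fun j => a j i) ∈ R

theorem IsCentral.comp_mem {ρ : Set (Fin h → A)} (hρ : IsCentral ρ) {x : Fin h → A} (hx : x ∈ ρ)
    (q : Fin h → Fin h) : (fun i => x (q i)) ∈ ρ := by
  by_cases hq : Injective q
  · exact hρ.totallySymmetric (Equiv.ofBijective q (Finite.injective_iff_bijective.1 hq)) x hx
  · simp only [Injective, not_forall] at hq
    obtain ⟨i, j, hij, hne⟩ := hq
    exact hρ.totallyReflexive _ ⟨i, j, hne, congrArg x hij⟩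

theorem IsCentral.mem_of_center {ρ : Set (Fin h → A)} (hρ : IsCentral ρ) {c : A}
    (hc : c ∈ center ρ) {x : Fin h → A} (i : Fin h) (hi : x i = c) : x ∈ ρ := by
  have h1 := hc (fun j => x (Equiv.swap ⟨0, hρ.arity_pos⟩ i j))
    ⟨⟨0, hρ.arity_pos⟩, rfl, by simpa using hi⟩
  simpa using hρ.totallySymmetric (Equiv.swap ⟨0, hρ.arity_pos⟩ i) _ h1

theorem IsCentral.injective_of_notMem {ρ : Set (Fin h → A)} (hρ : IsCentral ρ) {x : Fin h → A}
    (hx : x ∉ ρ) : Injective x := by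
  intro i j hij
  by_contra hne
  exact hx (hρ.totallyReflexive _ ⟨i, j, hne, hij⟩)

theorem IsCentral.exists_notMem_of_notMem_center {ρ : Set (Fin h → A)} (hρ : IsCentral ρ) {c : A}
    (hc : c ∉ center ρ) (i : Fin h) : ∃ x, x ∉ ρ ∧ x i = c := by
  simp only [center, Set.mem_ofPred_eq, not_forall] at hc
  obtain ⟨x, ⟨j, -, hj⟩, hx⟩ := hc
  refine ⟨fun l => x (Equiv.swap i j l), fun hmem => hx ?_, by simpa using hj⟩
  simpa using hρ.comp_mem hmem (Equiv.swap i j)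

theorem IsCentral.exists_notMem {ρ : Set (Fin h → A)} (hρ : IsCentral ρ) : ∃ x, x ∉ ρ := by
  obtain ⟨c, hc⟩ := (Set.ne_univ_iff_exists_notMem _).1 hρ.center_ne_univ
  obtain ⟨x, hx, -⟩ := hρ.exists_notMem_of_notMem_center hc ⟨0, hρ.arity_pos⟩
  exact ⟨x, hx⟩

theorem IsCentral.exists_ne {ρ : Set (Fin h → A)} (hρ : IsCentral ρ) (c : A) : ∃ a, a ≠ c := by
  by_contra! hall
  obtain ⟨d, hd⟩ := hρ.center_nonempty
  obtain ⟨e, he⟩ := (Set.ne_univ_iff_exists_notMem _).1 hρ.center_ne_univ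
  exact he (by rw [hall e, ← hall d]; exact hd)

theorem IsCentral.const_mem {ρ : Set (Fin h → A)} (hρ : IsCentral ρ) (hh : 2 ≤ h) (a : A) :
    (fun _ => a) ∈ ρ :=
  hρ.totallyReflexive _ ⟨⟨0, by omega⟩, ⟨1, by omega⟩, by simp, rfl⟩

theorem IsCentral.mem_center_of_update {ρ : Set (Fin h → A)} (hρ : IsCentral ρ) {u : A} (i : Fin h)
    (hu : ∀ x : Fin h → A, update x i u ∈ ρ) : u ∈ center ρ := by
  by_contra hc
  obtain ⟨x, hx, hi⟩ := hρ.exists_notMem_of_notMem_center hc i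
  exact hx (by simpa [← hi] using hu x)

theorem IsCentral.update_mem_of_center {ρ : Set (Fin h → A)} (hρ : IsCentral ρ) {c : A}
    (hc : c ∈ center ρ) (x : Fin h → A) (i : Fin h) : update x i c ∈ ρ :=
  hρ.mem_of_center hc i (by simp)

/-- Extending a partial operation by a central value preserves a central relation, provided the
partial operation does. -/
theorem IsCentral.preservesOn_extend {ρ : Set (Fin h → A)} (hρ : IsCentral ρ) {c : A}
    (hc : c ∈ center ρ) {I N : Type*} {X : I → N → A} (hX : Injective X) (y : I → A)
    (H : ∀ q : Fin h → I, Injective q → (∀ n, (fun m => X (q m) n) ∈ ρ) →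
      (fun m => y (q m)) ∈ ρ) : PreservesOn (extend X y fun _ => c) ρ := by
  intro a ha
  by_cases hall : ∀ m, ∃ i, X i = fun j => a j m
  · choose q hq using hall
    have hval : (fun m => extend X y (fun _ => c) fun j => a j m) = fun m => y (q m) := by
      funext m
      rw [← hq m, hX.extend_apply]
    rw [hval]
    by_cases hinj : Injective q
    · refine H q hinj fun n => ?_
      simpa [hq] using ha n
    · simp only [Injective, not_forall] at hinj
      obtain ⟨i, j, hij, hne⟩ := hinj
      exact hρ.totallyReflexive _ ⟨i, j, hne, congrArg y hij⟩
  · push Not at hall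
    obtain ⟨m, hm⟩ := hall
    exact hρ.mem_of_center hc m (extend_apply' _ _ _ fun ⟨i, hi⟩ => hm i hi)

/-- The rows of the matrix whose columns are all tuples of `R`. -/
def rows {A ι : Type*} (R : Set (ι → A)) : ι → R → A := fun i t => t.1 i

theorem rows_injective {ι : Type*} {R : Set (ι → A)} (hR : ∀ i j, i ≠ j → ∃ t ∈ R, t i ≠ t j) :
    Injective (rows R) := by
  intro i j hij
  by_contra hne
  obtain ⟨t, ht, htne⟩ := hR i j hne
  exact htne (congrFun hij ⟨t, ht⟩)

theorem IsCentral.rows_injective {σ : Set (Fin s → A)} (hσ : IsCentral σ) :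
    Injective (rows σ) := by
  refine CloneTheory.rows_injective fun i j hij => ?_
  obtain ⟨c, hc⟩ := hσ.center_nonempty
  obtain ⟨a, ha⟩ := hσ.exists_ne c
  exact ⟨update (fun _ => a) i c, hσ.update_mem_of_center hc _ _, by simpa [hij.symm] using ha.symm⟩

/-- A tuple lies in every nonempty relation `R` preserved by `Pol ρ` that has enough columns to
avoid the obstructions coming from `ρ`. -/
theorem IsCentral.mem_of_preserved {ρ : Set (Fin h → A)} (hρ : IsCentral ρ) {ι : Type*}
    {R : Set (ι → A)}
    (hD : ∀ f : (R → A) → A, PreservesOn f ρ → PreservesOn f R)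
    (hR : ∀ i j, i ≠ j → ∃ t ∈ R, t i ≠ t j) (y : ι → A)
    (H : ∀ q : Fin h → ι, Injective q → (fun m => y (q m)) ∈ ρ ∨ ∃ t ∈ R, (fun m => t (q m)) ∉ ρ) :
    y ∈ R := by
  obtain ⟨c, hc⟩ := hρ.center_nonempty
  have hX := CloneTheory.rows_injective hR
  have hf : PreservesOn (extend (rows R) y fun _ => c) ρ := by
    refine hρ.preservesOn_extend hc hX y fun q hq hcol => ?_
    rcases H q hq with h1 | ⟨t, ht, htq⟩
    · exact h1
    · exact absurd (hcol ⟨t, ht⟩) htq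
  have := hD _ hf (fun t => t.1) fun t => t.2
  convert this using 1
  funext i
  exact (hX.extend_apply y _ i).symm

end Basic

/-! ### Clones and the maximality dichotomy -/

section Clones

variable {A : Type} {h s : ℕ}

theorem preservesOn_reindex {N M ι : Type} (e : N → M) {f : (N → A) → A} {R : Set (ι → A)}
    (hf : PreservesOn f R) : PreservesOn (fun x : M → A => f fun j => x (e j)) R :=
  fun a ha => hf (fun j => a (e j)) fun j => ha (e j)

/-- The operations of a clone that preserve a further relation. -/
def OpClone.restrict {ι : Type} (C : OpClone A) (R : Set (ι → A)) : OpClone A where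
  ops n := {f | f ∈ C.ops n ∧ PreservesOn f R}
  ops_zero := by simp [C.ops_zero]
  proj_mem n i := ⟨C.proj_mem n i, fun _ ha => ha i⟩
  comp_mem m n g f hg hf := ⟨C.comp_mem m n g f hg.1 fun i => (hf i).1,
    fun a ha => hg.2 _ fun i => (hf i).2 a ha⟩

theorem mem_pol_single {ρ : Set (Fin h → A)} {n : ℕ} {f : (Fin n → A) → A} :
    f ∈ (Pol ({⟨h, ρ⟩} : Set (FinRel A))).ops n ↔ 0 < n ∧ PreservesOn f ρ := by
  simp [Pol, Preserves, PreservesOn]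

theorem mem_pol_pair {ρ : Set (Fin h → A)} {σ : Set (Fin s → A)} {n : ℕ} {f : (Fin n → A) → A} :
    f ∈ (Pol ({⟨h, ρ⟩, ⟨s, σ⟩} : Set (FinRel A))).ops n ↔
      0 < n ∧ PreservesOn f ρ ∧ PreservesOn f σ := by
  simp [Pol, Preserves, PreservesOn]

/-- If `Pol {ρ, σ}` is maximal below `Pol ρ`, an invariant relation of the former is either an
invariant relation of the latter or forces the preservation of `σ`. -/
theorem preserved_or_of_covBy {ρ : Set (Fin h → A)} {σ : Set (Fin s → A)}
    (hcov : Pol ({⟨h, ρ⟩, ⟨s, σ⟩} : Set (FinRel A)) ⋖ Pol ({⟨h, ρ⟩} : Set (FinRel A)))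
    {ι : Type} {R : Set (ι → A)}
    (hR : ∀ n (f : (Fin n → A) → A), PreservesOn f ρ → PreservesOn f σ → PreservesOn f R) :
    (∀ (N : Type) [Finite N] [Nonempty N] (f : (N → A) → A),
      PreservesOn f ρ → PreservesOn f R) ∨
    (∀ (N : Type) [Finite N] [Nonempty N] (f : (N → A) → A),
      PreservesOn f ρ → PreservesOn f R → PreservesOn f σ) := by
  have h1 : Pol ({⟨h, ρ⟩, ⟨s, σ⟩} : Set (FinRel A)) ≤
      (Pol ({⟨h, ρ⟩} : Set (FinRel A))).restrict R := by
    intro n f hf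
    rw [mem_pol_pair] at hf
    exact ⟨mem_pol_single.2 ⟨hf.1, hf.2.1⟩, hR n f hf.2.1 hf.2.2⟩
  have h2 : (Pol ({⟨h, ρ⟩} : Set (FinRel A))).restrict R ≤ Pol ({⟨h, ρ⟩} : Set (FinRel A)) :=
    fun n f hf => hf.1
  have key : ∀ (N : Type) [Finite N] [Nonempty N] (f : (N → A) → A), PreservesOn f ρ →
      ∃ (n : ℕ) (e : N ≃ Fin n), (fun x : Fin n → A => f fun j => x (e j)) ∈
        (Pol ({⟨h, ρ⟩} : Set (FinRel A))).ops n := by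
    intro N _ _ f hf
    obtain ⟨n, ⟨e⟩⟩ := Finite.exists_equiv_fin N
    exact ⟨n, e, mem_pol_single.2 ⟨(e (Classical.arbitrary N)).pos, preservesOn_reindex e hf⟩⟩
  have back : ∀ {N κ : Type} {n : ℕ} (e : N ≃ Fin n) (f : (N → A) → A) (T : Set (κ → A)),
      PreservesOn (fun x : Fin n → A => f fun j => x (e j)) T → PreservesOn f T := by
    intro N κ n e f T hT
    simpa using preservesOn_reindex e.symm hT
  rcases hcov.eq_or_eq h1 h2 with heq | heq
  · right
    intro N _ _ f hf hfR
    obtain ⟨n, e, he⟩ := key N f hf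
    have : (fun x : Fin n → A => f fun j => x (e j)) ∈
        ((Pol ({⟨h, ρ⟩} : Set (FinRel A))).restrict R).ops n :=
      ⟨he, preservesOn_reindex e hfR⟩
    rw [heq, mem_pol_pair] at this
    exact back e f σ this.2.2
  · left
    intro N _ _ f hf
    obtain ⟨n, e, he⟩ := key N f hf
    rw [← heq] at he
    exact back e f R he.2

/-- Composition in a clone with an operation on a finite index type. -/
theorem OpClone.comp_mem_of_finite (G : OpClone A) {N : Type} [Finite N] {n : ℕ}
    (H : (N → A) → A)
    (hH : ∀ (m : ℕ) (e : N ≃ Fin m), (fun x : Fin m → A => H fun j => x (e j)) ∈ G.ops m)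
    (F : N → (Fin n → A) → A) (hF : ∀ j, F j ∈ G.ops n) :
    (fun x => H fun j => F j x) ∈ G.ops n := by
  obtain ⟨m, ⟨e⟩⟩ := Finite.exists_equiv_fin N
  simpa using G.comp_mem m n _ (fun i => F (e.symm i)) (hH m e) fun i => hF _

theorem covBy_of_generates {ρ : Set (Fin h → A)} {σ : Set (Fin s → A)}
    (hlt : ∃ (N : Type) (_ : Finite N) (_ : Nonempty N) (f : (N → A) → A),
      PreservesOn f ρ ∧ ¬ PreservesOn f σ)
    (hgen : ∀ G : OpClone A, Pol ({⟨h, ρ⟩, ⟨s, σ⟩} : Set (FinRel A)) ≤ G →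
      ∀ n (f : (Fin n → A) → A), f ∈ G.ops n → PreservesOn f ρ → ¬ PreservesOn f σ →
      ∀ m (g : (Fin m → A) → A), 0 < m → PreservesOn g ρ → g ∈ G.ops m) :
    Pol ({⟨h, ρ⟩, ⟨s, σ⟩} : Set (FinRel A)) ⋖ Pol ({⟨h, ρ⟩} : Set (FinRel A)) := by
  have hle : Pol ({⟨h, ρ⟩, ⟨s, σ⟩} : Set (FinRel A)) ≤ Pol ({⟨h, ρ⟩} : Set (FinRel A)) := by
    intro n f hf
    rw [mem_pol_pair] at hf
    exact mem_pol_single.2 ⟨hf.1, hf.2.1⟩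
  refine ⟨lt_of_le_of_ne hle ?_, ?_⟩
  · intro heq
    obtain ⟨N, _, _, f, hf, hfσ⟩ := hlt
    obtain ⟨n, ⟨e⟩⟩ := Finite.exists_equiv_fin N
    have hmem : (fun x : Fin n → A => f fun j => x (e j)) ∈
        (Pol ({⟨h, ρ⟩} : Set (FinRel A))).ops n :=
      mem_pol_single.2 ⟨(e (Classical.arbitrary N)).pos, preservesOn_reindex e hf⟩
    rw [← heq, mem_pol_pair] at hmem
    exact hfσ (by simpa using preservesOn_reindex e.symm hmem.2.2)
  · intro G hCG hGD
    apply hGD.not_ge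
    have hex : ∃ n, ∃ f ∈ G.ops n, f ∉ (Pol ({⟨h, ρ⟩, ⟨s, σ⟩} : Set (FinRel A))).ops n := by
      by_contra! hall
      exact hCG.not_ge fun n f hf => hall n f hf
    obtain ⟨n, f, hf, hfC⟩ := hex
    have hfD := mem_pol_single.1 (hGD.le n hf)
    intro m g hg
    rw [mem_pol_single] at hg
    exact hgen G hCG.le n f hf hfD.2 (fun hσ => hfC (mem_pol_pair.2 ⟨hfD.1, hfD.2, hσ⟩)) m g
      hg.1 hg.2

end Clones

/-! ### Sufficiency when the centers meet -/

section Sufficiency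

variable {A : Type} {h s : ℕ}

/-- An injective selection of coordinates is the restriction of a permutation. -/
theorem exists_perm_castLE {e : h ≤ s} {q : Fin h → Fin s} (hq : Injective q) :
    ∃ π : Equiv.Perm (Fin s), ∀ i, π (q i) = Fin.castLE e i := by
  classical
  let e₁ := Equiv.ofInjective q hq
  let e₂ := Equiv.ofInjective (Fin.castLE e) (Fin.castLE_injective e)
  refine ⟨(e₁.symm.trans e₂ :
    {x // x ∈ Set.range q} ≃ {x // x ∈ Set.range (Fin.castLE e)}).extendSubtype, fun i => ?_⟩
  rw [Equiv.extendSubtype_apply_of_mem _ _ ⟨i, rfl⟩]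
  have : e₁.symm ⟨q i, i, rfl⟩ = i := e₁.symm_apply_apply i
  simp only [Equiv.trans_apply, this]
  rfl

/-- Sending the matrix of all tuples of `σ` to a tuple outside `σ` gives an operation of `Pol ρ`
that does not preserve `σ`. -/
theorem not_preservesOn_extend_rows {σ : Set (Fin s → A)} (hσ : IsCentral σ) {w : Fin s → A}
    (hw : w ∉ σ) (c : A) : ¬ PreservesOn (extend (rows σ) w fun _ => c) σ := by
  intro hp
  refine hw ?_
  convert hp (fun t => t.1) fun t => t.2 using 1
  funext i
  exact (hσ.rows_injective.extend_apply w _ i).symm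

theorem exists_preservesOn_not [Finite A] {ρ : Set (Fin h → A)} {σ : Set (Fin s → A)}
    (hρ : IsCentral ρ) (hσ : IsCentral σ) {w : Fin s → A} (hw : w ∉ σ)
    (H : ∀ q : Fin h → Fin s, Injective q →
      (fun m => w (q m)) ∈ ρ ∨ ∃ t ∈ σ, (fun m => t (q m)) ∉ ρ) :
    ∃ (N : Type) (_ : Finite N) (_ : Nonempty N) (f : (N → A) → A),
      PreservesOn f ρ ∧ ¬ PreservesOn f σ := by
  obtain ⟨c, hc⟩ := hρ.center_nonempty
  obtain ⟨d, hd⟩ := hσ.center_nonempty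
  refine ⟨σ, inferInstance, ⟨fun _ => d, hσ.mem_of_center hd ⟨0, hσ.arity_pos⟩ rfl⟩,
    extend (rows σ) w fun _ => c, ?_, not_preservesOn_extend_rows hσ hw c⟩
  refine hρ.preservesOn_extend hc hσ.rows_injective w fun q hq hcol => ?_
  rcases H q hq with h1 | ⟨t, ht, htq⟩
  · exact h1
  · exact absurd (hcol ⟨t, ht⟩) htq

/-- For every matrix `X` over `σ` that `g` maps outside `σ`, the clone has an `F X` that also maps
it outside `σ`. Passing all `F X` as extra arguments makes it safe to copy `g` where they are
consistent and to output `c` elsewhere. The alternative `hdich` is what makes the inner functions `K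
l` preserve `ρ`. -/
theorem covBy_of_common_center [Finite A] {ρ : Set (Fin h → A)} {σ : Set (Fin s → A)}
    (hρ : IsCentral ρ) (hσ : IsCentral σ) {c : A} (hcρ : c ∈ center ρ) (hcσ : c ∈ center σ)
    (hdich : (∀ q : Fin h → Fin s, Injective q → ∀ t ∈ σ, (fun m => t (q m)) ∈ ρ) ∨
      ∀ q : Fin h → Fin s, Injective q → ∀ t, (fun m => t (q m)) ∈ ρ → t ∈ σ)
    (hlt : ∃ (N : Type) (_ : Finite N) (_ : Nonempty N) (f : (N → A) → A),
      PreservesOn f ρ ∧ ¬ PreservesOn f σ) :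
    Pol ({⟨h, ρ⟩, ⟨s, σ⟩} : Set (FinRel A)) ⋖ Pol ({⟨h, ρ⟩} : Set (FinRel A)) := by
  refine covBy_of_generates hlt fun G hCG n f hf hfρ hfσ m g hm hg => ?_
  simp only [PreservesOn, not_forall] at hfσ
  obtain ⟨a, haσ, hfa⟩ := hfσ
  let Bad := {X : Fin m → Fin s → A // (∀ j, X j ∈ σ) ∧ (fun i => g fun j => X j i) ∉ σ}
  have hF : ∀ X : Bad, ∃ F ∈ G.ops m, (fun i => F fun j => X.1 j i) ∉ σ := by
    rintro ⟨X, hXσ, hgX⟩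
    have hXinj : Injective fun i j => X j i := fun i i' hii =>
      hσ.injective_of_notMem hgX (congrArg g hii)
    -- `K l` sends the rows of `X` to the tuple `a l` on which `f` violates `σ`, so composing `f`
    -- with the `K l` sends `X` to the bad tuple.
    let K : Fin n → (Fin m → A) → A := fun l => extend (fun i j => X j i) (a l) fun _ => c
    have hK : ∀ l, K l ∈ G.ops m := by
      refine fun l => hCG m (mem_pol_pair.2 ⟨hm, ?_, ?_⟩)
      · refine hρ.preservesOn_extend hcρ hXinj _ fun q hq hcol => ?_
        rcases hdich with h1 | h2
        · exact h1 q hq _ (haσ l)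
        · exact absurd (h2 q hq _ (hg (fun j m => X j (q m)) hcol)) hgX
      · exact hσ.preservesOn_extend hcσ hXinj _ fun q _ _ => hσ.comp_mem (haσ l) q
    refine ⟨_, G.comp_mem n m f K hf hK, ?_⟩
    have hKX : ∀ l i, K l (fun j => X j i) = a l i := fun l i => hXinj.extend_apply (a l) _ i
    simpa only [hKX] using hfa
  choose F hFG hFX using hF
  classical
  let H : (Fin m ⊕ Bad → A) → A := fun z =>
    if ∀ X : Bad, z (Sum.inr X) = F X fun j => z (Sum.inl j) then g fun j => z (Sum.inl j) else c
  have hHρ : PreservesOn H ρ := by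
    intro b hb
    by_cases hall : ∀ i, ∀ X : Bad, b (Sum.inr X) i = F X fun j => b (Sum.inl j) i
    · have : (fun i => H fun j => b j i) = fun i => g fun j => b (Sum.inl j) i := by
        funext i
        exact if_pos (hall i)
      rw [this]
      exact hg _ fun j => hb _
    · push Not at hall
      obtain ⟨i, X, hX⟩ := hall
      exact hρ.mem_of_center hcρ i (if_neg fun hi => hX (hi X))
  have hHσ : PreservesOn H σ := by
    intro b hb
    by_cases hall : ∀ i, ∀ X : Bad, b (Sum.inr X) i = F X fun j => b (Sum.inl j) i
    · have : (fun i => H fun j => b j i) = fun i => g fun j => b (Sum.inl j) i := by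
        funext i
        exact if_pos (hall i)
      rw [this]
      by_contra hbad
      let X : Bad := ⟨fun j => b (Sum.inl j), fun j => hb _, hbad⟩
      apply hFX X
      have hbX := hb (Sum.inr X)
      convert hbX using 1
      funext i
      exact (hall i X).symm
    · push Not at hall
      obtain ⟨i, X, hX⟩ := hall
      exact hσ.mem_of_center hcσ i (if_neg fun hi => hX (hi X))
  have := G.comp_mem_of_finite H (fun M e => hCG M (mem_pol_pair.2
    ⟨(e (Sum.inl ⟨0, hm⟩)).pos, preservesOn_reindex e hHρ, preservesOn_reindex e hHσ⟩))
    (Sum.elim (fun j x => x j) F) (by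
      rintro (j | X)
      · exact G.proj_mem m j
      · exact hFG X)
  convert this using 1
  funext x
  simp [H]

end Sufficiency

/-! ### Unary `σ`: sufficiency of the chain condition -/

section Unary

variable {A : Type}

theorem mem_fin_one_iff {σ : Set (Fin 1 → A)} {x : Fin 1 → A} : x ∈ σ ↔ x 0 ∈ unarySet σ := by
  have : x = ![x 0] := by
    funext i
    fin_cases i
    rfl
  rw [unarySet, Set.mem_ofPred_eq, ← this]

theorem preservesOn_unary_iff {N : Type} {σ : Set (Fin 1 → A)} {f : (N → A) → A} :
    PreservesOn f σ ↔ ∀ x : N → A, (∀ j, x j ∈ unarySet σ) → f x ∈ unarySet σ := by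
  constructor
  · intro hf x hx
    exact mem_fin_one_iff.1 (hf (fun j _ => x j) fun j => mem_fin_one_iff.2 (hx j))
  · intro hf a ha
    exact mem_fin_one_iff.2 (hf (fun j => a j 0) fun j => mem_fin_one_iff.1 (ha j))

theorem mem_fin_two_iff {ρ : Set (Fin 2 → A)} {x : Fin 2 → A} : x ∈ ρ ↔ ![x 0, x 1] ∈ ρ := by
  have : x = ![x 0, x 1] := by
    funext i
    fin_cases i <;> rfl
  rw [← this]

theorem preservesOn_binary_iff {N : Type} {ρ : Set (Fin 2 → A)} {f : (N → A) → A} :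
    PreservesOn f ρ ↔ ∀ x y : N → A, (∀ j, ![x j, y j] ∈ ρ) → ![f x, f y] ∈ ρ := by
  constructor
  · intro hf x y hxy
    simpa using mem_fin_two_iff.1 (hf (fun j => ![x j, y j]) hxy)
  · intro hf a ha
    exact mem_fin_two_iff.2 (hf (fun j => a j 0) (fun j => a j 1) fun j => mem_fin_two_iff.1 (ha j))

theorem center_eq_unarySet {σ : Set (Fin 1 → A)} : center σ = unarySet σ := by
  ext a
  constructor
  · intro ha
    exact ha _ ⟨0, rfl, rfl⟩
  · rintro ha x ⟨i, -, hi⟩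
    rw [mem_fin_one_iff, Subsingleton.elim 0 i, hi]
    exact ha

theorem IsCentral.symm_two {ρ : Set (Fin 2 → A)} (hρ : IsCentral ρ) {a b : A} (hab : ![a, b] ∈ ρ) :
    ![b, a] ∈ ρ := by
  simpa using mem_fin_two_iff.1 (hρ.comp_mem hab (Equiv.swap 0 1))

theorem IsCentral.refl_two {ρ : Set (Fin 2 → A)} (hρ : IsCentral ρ) (a : A) : ![a, a] ∈ ρ :=
  hρ.totallyReflexive _ ⟨0, 1, by simp, rfl⟩

theorem isRelChain_two_iff {ρ : Set (Fin 2 → A)} {B : Set A} :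
    IsRelChain ρ B ↔ ∀ a ∈ B, ∀ b ∈ B, ![a, b] ∈ ρ := by
  constructor
  · intro hB a ha b hb
    exact hB _ fun i => by fin_cases i <;> simpa
  · intro hB x hx
    exact mem_fin_two_iff.2 (hB _ (hx 0) _ (hx 1))

theorem exists_adjacent_of_chain [Finite A] {ρ : Set (Fin 2 → A)} {U : Set A}
    (hmax : ∀ B : Set A, Maximal (IsRelChain ρ) B → (B ∩ U).Nonempty) {S : Set A}
    (hS : IsRelChain ρ S) : ∃ u ∈ U, ∀ z ∈ S, ![z, u] ∈ ρ := by
  obtain ⟨B, hSB, hB⟩ := (Set.toFinite {B : Set A | IsRelChain ρ B}).exists_le_maximal hS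
  obtain ⟨u, huB, huU⟩ := hmax B hB
  exact ⟨u, huU, fun z hz => isRelChain_two_iff.1 hB.prop z (hSB hz) u huB⟩

/-- Applying `f` to constants of `σ` puts a constant outside `σ` into the clone. This constant
serves as a switch: with it `H` is `g`, while on arguments from `σ` the value of `g` is replaced by
an element of `σ` adjacent to all values of `g` nearby. -/
theorem covBy_of_chains [Finite A] {ρ : Set (Fin 2 → A)} {σ : Set (Fin 1 → A)}
    (hρ : IsCentral ρ) (hcn : ρ = commonNeighbour ρ σ)
    (hmax : ∀ B : Set A, Maximal (IsRelChain ρ) B → (B ∩ unarySet σ).Nonempty)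
    (hlt : ∃ (N : Type) (_ : Finite N) (_ : Nonempty N) (f : (N → A) → A),
      PreservesOn f ρ ∧ ¬ PreservesOn f σ) :
    Pol ({⟨2, ρ⟩, ⟨1, σ⟩} : Set (FinRel A)) ⋖ Pol ({⟨2, ρ⟩} : Set (FinRel A)) := by
  refine covBy_of_generates hlt fun G hCG n f hf hfρ hfσ m g hm hg => ?_
  rw [preservesOn_unary_iff] at hfσ
  push Not at hfσ
  obtain ⟨a, ha, hb⟩ := hfσ
  have hclique : ∀ u ∈ unarySet σ, ∀ x y, ![x, u] ∈ ρ → ![y, u] ∈ ρ → ![x, y] ∈ ρ := by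
    intro u hu x y hx hy
    rw [hcn]
    exact ⟨u, hu, hx, hy⟩
  have hbG : (fun _ : Fin m → A => f a) ∈ G.ops m := by
    refine G.comp_mem n m f (fun l _ => a l) hf fun l => hCG m (mem_pol_pair.2 ⟨hm, ?_, ?_⟩)
    · exact preservesOn_binary_iff.2 fun _ _ _ => hρ.refl_two _
    · exact preservesOn_unary_iff.2 fun _ _ => ha l
  rw [preservesOn_binary_iff] at hg
  classical
  let nbr : (Fin m → A) → Set (Fin m → A) := fun x => {z | ∀ j, ![z j, x j] ∈ ρ}
  have hnbr : ∀ x : Fin m → A, (∀ j, x j ∈ unarySet σ) →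
      ∃ u ∈ unarySet σ, ∀ z ∈ nbr x, ![g z, u] ∈ ρ := by
    intro x hx
    have hch : IsRelChain ρ (g '' nbr x) := by
      rw [isRelChain_two_iff]
      rintro _ ⟨y, hy, rfl⟩ _ ⟨z, hz, rfl⟩
      exact hg y z fun j => hclique _ (hx j) _ _ (hy j) (hz j)
    obtain ⟨u, hu, huz⟩ := exists_adjacent_of_chain hmax hch
    exact ⟨u, hu, fun z hz => huz _ ⟨z, hz, rfl⟩⟩
  -- The choice depends only on the neighbourhood: adjacent points with entries in `σ` have equal
  -- neighbourhoods, so they get the same value. The default is never reached on such points.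
  let v : Set (Fin m → A) → A := fun S =>
    if hS : ∃ u ∈ unarySet σ, ∀ z ∈ S, ![g z, u] ∈ ρ then hS.choose else f a
  have hv : ∀ x : Fin m → A, (∀ j, x j ∈ unarySet σ) →
      v (nbr x) ∈ unarySet σ ∧ ∀ z ∈ nbr x, ![g z, v (nbr x)] ∈ ρ := by
    intro x hx
    have hS := hnbr x hx
    simp only [v, dif_pos hS]
    exact hS.choose_spec
  have hnbr_sub : ∀ x y : Fin m → A, (∀ j, x j ∈ unarySet σ) → (∀ j, y j ∈ unarySet σ) →
      (∀ j, ![x j, y j] ∈ ρ) → nbr x ⊆ nbr y := by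
    intro x y hx hy hxy z hz j
    exact hclique _ (hx j) _ _ (hz j) (hρ.symm_two (hxy j))
  let H : (Option (Fin m) → A) → A := fun z =>
    if z none ≠ f a ∧ ∀ j, z (some j) ∈ unarySet σ then v (nbr fun j => z (some j))
    else g fun j => z (some j)
  have hHρ : PreservesOn H ρ := by
    rw [preservesOn_binary_iff]
    intro x y hxy
    simp only [H]
    split_ifs with h1 h2 h2
    · have heq : nbr (fun j => x (some j)) = nbr fun j => y (some j) :=
        (hnbr_sub _ _ h1.2 h2.2 fun j => hxy _).antisymm
          (hnbr_sub _ _ h2.2 h1.2 fun j => hρ.symm_two (hxy _))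
      rw [heq]
      exact hρ.refl_two _
    · exact hρ.symm_two ((hv _ h1.2).2 _ fun j => hρ.symm_two (hxy _))
    · exact (hv _ h2.2).2 _ fun j => hxy _
    · exact hg _ _ fun j => hxy _
  have hHσ : PreservesOn H σ := by
    rw [preservesOn_unary_iff]
    intro x hx
    have hcond : x none ≠ f a ∧ ∀ j, x (some j) ∈ unarySet σ :=
      ⟨fun heq => hb (heq ▸ hx none), fun j => hx _⟩
    simp only [H, if_pos hcond]
    exact (hv _ hcond.2).1
  have := G.comp_mem_of_finite H (fun M e => hCG M (mem_pol_pair.2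
    ⟨(e none).pos, preservesOn_reindex e hHρ, preservesOn_reindex e hHσ⟩))
    (fun j => j.elim (fun _ => f a) fun j x => x j) (by
      rintro (_ | j)
      · exact hbG
      · exact G.proj_mem m j)
  convert this using 1
  funext x
  simp [H]

end Unary

/-! ### Unary `σ`: necessity -/

section UnaryNecessity

variable {A : Type} [Finite A] {h : ℕ}

/-- The constant operation `c` preserves `ρ` and `R` but not `σ`, so maximality makes `R` invariant
under `Pol ρ`. -/
theorem mem_of_unary_covBy {ρ : Set (Fin h → A)} {σ : Set (Fin 1 → A)} (hρ : IsCentral ρ)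
    (hσ : IsCentral σ) (hh : 2 ≤ h) {c : A} (hcσ : c ∉ unarySet σ)
    (hcov : Pol ({⟨h, ρ⟩, ⟨1, σ⟩} : Set (FinRel A)) ⋖ Pol ({⟨h, ρ⟩} : Set (FinRel A)))
    {ι : Type} [Finite ι] {R : Set (ι → A)}
    (hR : ∀ n (f : (Fin n → A) → A), PreservesOn f ρ → PreservesOn f σ → PreservesOn f R)
    (hcR : (fun _ => c) ∈ R) (hsep : ∀ i j, i ≠ j → ∃ t ∈ R, t i ≠ t j) (y : ι → A)
    (H : ∀ q : Fin h → ι, Injective q → (fun m => y (q m)) ∈ ρ ∨ ∃ t ∈ R, (fun m => t (q m)) ∉ ρ) :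
    y ∈ R := by
  have : Nonempty R := ⟨⟨_, hcR⟩⟩
  rcases preserved_or_of_covBy hcov hR with h1 | h1
  · exact hρ.mem_of_preserved (h1 R) hsep y H
  · obtain ⟨u, hu⟩ := hσ.center_nonempty
    rw [center_eq_unarySet] at hu
    have := h1 Unit (fun _ => c) (fun _ _ => hρ.const_mem hh c) fun _ _ => hcR
    exact absurd (preservesOn_unary_iff.1 this (fun _ => u) fun _ => hu) hcσ

theorem typeI_of_covBy_of_three_le {ρ : Set (Fin h → A)} {σ : Set (Fin 1 → A)} (hρ : IsCentral ρ)
    (hσ : IsCentral σ) (hh : 3 ≤ h)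
    (hcov : Pol ({⟨h, ρ⟩, ⟨1, σ⟩} : Set (FinRel A)) ⋖ Pol ({⟨h, ρ⟩} : Set (FinRel A))) :
    (center ρ ∩ unarySet σ).Nonempty := by
  classical
  obtain ⟨c, hc⟩ := hρ.center_nonempty
  by_cases hcσ : c ∈ unarySet σ
  · exact ⟨c, hc, hcσ⟩
  obtain ⟨u₀, hu₀⟩ := hσ.center_nonempty
  rw [center_eq_unarySet] at hu₀
  obtain ⟨a₀, ha₀⟩ := hρ.exists_ne c
  let z : Fin h := ⟨0, by omega⟩
  let I := {i : Fin h // i ≠ z}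
  -- the block of coordinates `x` completed by the value `u`
  let ext : (I → A) → A → Fin h → A := fun x u i => if hi : i = z then u else x ⟨i, hi⟩
  have ext_z : ∀ x u, ext x u z = u := fun x u => dif_pos rfl
  have ext_of_center : ∀ x u, (∃ i, x i = c) → ext x u ∈ ρ := by
    rintro x u ⟨i, hi⟩
    exact hρ.mem_of_center hc i.1 (by simp only [ext, dif_neg i.2]; exact hi)
  let i₁ : I := ⟨⟨1, by omega⟩, by simp [z, Fin.ext_iff]⟩
  let i₂ : I := ⟨⟨2, by omega⟩, by simp [z, Fin.ext_iff]⟩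
  have hi₁₂ : i₁ ≠ i₂ := fun he => by
    simpa [i₁, i₂] using congrArg (fun i : I => i.1.val) he
  have ext_of_eq : ∀ x u, x i₁ = x i₂ → ext x u ∈ ρ := by
    intro x u hx
    refine hρ.totallyReflexive _ ⟨i₁.1, i₂.1, fun hne => hi₁₂ (Subtype.ext hne), ?_⟩
    simp only [ext, dif_neg i₁.2, dif_neg i₂.2]
    exact hx
  have ext_map : ∀ {n : ℕ} (f : (Fin n → A) → A) (x : Fin n → I → A) (u : Fin n → A),
      ext (fun i => f fun j => x j i) (f u) = fun i => f fun j => ext (x j) (u j) i := by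
    intro n f x u
    funext i
    by_cases hi : i = z <;> simp [ext, hi]
  -- Only `h - 1` coordinates are present, so no injective choice of `h` of them can obstruct.
  have single : ∀ y : I → A, ∃ u ∈ unarySet σ, ext y u ∈ ρ := by
    intro y
    refine mem_of_unary_covBy hρ hσ (by omega) hcσ hcov
      (R := {y | ∃ u ∈ unarySet σ, ext y u ∈ ρ}) ?_ ?_ ?_ y ?_
    · intro n f hfρ hfσ x hx
      choose u hu hxu using hx
      refine ⟨f u, preservesOn_unary_iff.1 hfσ u hu, ?_⟩
      rw [ext_map]
      exact hfρ _ hxu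
    · exact ⟨u₀, hu₀, ext_of_center (fun _ => c) u₀ ⟨i₁, rfl⟩⟩
    · intro i j hij
      exact ⟨update (fun _ => a₀) i c, ⟨u₀, hu₀, ext_of_center _ _ ⟨i, by simp⟩⟩,
        by simpa [hij.symm] using ha₀.symm⟩
    · intro q hq
      have hcard := Fintype.card_le_of_injective q hq
      simp [I] at hcard
      omega
  have blocks : ∀ y : ((I → A) × I) → A, ∃ u ∈ unarySet σ, ∀ k, ext (fun l => y (k, l)) u ∈ ρ := by
    intro y
    refine mem_of_unary_covBy hρ hσ (by omega) hcσ hcov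
      (R := {y | ∃ u ∈ unarySet σ, ∀ k, ext (fun l => y (k, l)) u ∈ ρ}) ?_ ?_ ?_ y ?_
    · intro n f hfρ hfσ x hx
      choose u hu hxu using hx
      refine ⟨f u, preservesOn_unary_iff.1 hfσ u hu, fun k => ?_⟩
      rw [ext_map f (fun j l => x j (k, l))]
      exact hfρ _ fun j => hxu j k
    · exact ⟨u₀, hu₀, fun k => ext_of_center (fun _ => c) u₀ ⟨i₁, rfl⟩⟩
    · intro p p' hpp
      refine ⟨update (fun _ => c) p a₀, ⟨u₀, hu₀, fun k => ?_⟩, by simpa [hpp.symm] using ha₀⟩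
      by_cases hp : p = (k, i₁)
      · refine ext_of_center (fun l => update (fun _ => c) p a₀ (k, l)) u₀ ⟨i₂, ?_⟩
        simp [hp, hi₁₂.symm]
      · refine ext_of_center (fun l => update (fun _ => c) p a₀ (k, l)) u₀ ⟨i₁, ?_⟩
        simp [Ne.symm hp]
    · intro q hq
      right
      obtain ⟨v, hv⟩ := hρ.exists_notMem
      -- A choice that fills a block has just one coordinate outside it. `single` completes that
      -- block, and all other blocks are constant, hence harmless because `h ≥ 3` gives them two
      -- equal entries. If no block is filled, each contains a `c`.
      by_cases hfull : ∃ k, ∀ l, (k, l) ∈ Set.range q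
      · obtain ⟨k, hk⟩ := hfull
        choose r hr using hk
        have hrinj : Injective r := fun l l' hll => by
          have := (hr l).symm.trans ((congrArg q hll).trans (hr l'))
          simpa using this
        obtain ⟨m₀, hm₀⟩ : ∃ m₀, m₀ ∉ Set.range r := by
          by_contra! hall
          have := Fintype.card_le_of_surjective r hall
          simp [I] at this
          omega
        have hcover : ∀ m, m ≠ m₀ → ∃ l, r l = m := by
          have hinj : Injective fun l : I => (⟨r l, fun he => hm₀ ⟨l, he⟩⟩ : {m // m ≠ m₀}) :=
            fun l l' hll => hrinj (by simpa using hll)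
          have hbij := (Fintype.bijective_iff_injective_and_card _).2 ⟨hinj, by simp [I]⟩
          intro m hm
          obtain ⟨l, hl⟩ := hbij.2 ⟨m, hm⟩
          exact ⟨l, congrArg Subtype.val hl⟩
        obtain ⟨u, hu, hur⟩ := single fun l => v (r l)
        refine ⟨fun p => if p.1 = k then v (r p.2) else v m₀, ⟨u, hu, fun k' => ?_⟩, ?_⟩
        · by_cases hkk : k' = k
          · simpa [hkk] using hur
          · exact ext_of_eq (fun l => if k' = k then v (r l) else v m₀) u (by simp [hkk])
        · convert hv using 2
          funext m
          by_cases hm : m = m₀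
          · subst hm
            have hne : (q m).1 ≠ k := by
              intro he
              apply hm₀
              refine ⟨(q m).2, hq ?_⟩
              rw [hr, ← he]
            simp [hne]
          · obtain ⟨l, rfl⟩ := hcover m hm
            simp [hr]
      · push Not at hfull
        refine ⟨extend q v fun _ => c, ⟨u₀, hu₀, fun k => ?_⟩, ?_⟩
        · obtain ⟨l, hl⟩ := hfull k
          exact ext_of_center (fun l => extend q v (fun _ => c) (k, l)) u₀
            ⟨l, extend_apply' _ _ _ hl⟩
        · simpa [hq.extend_apply] using hv
  -- There is one block for each `I`-tuple over `A`, so this `u` completes all of them at once.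
  obtain ⟨u, hu, huk⟩ := blocks fun p => p.1 p.2
  refine ⟨u, hρ.mem_center_of_update z fun x => ?_, hu⟩
  convert huk fun l => x l.1 using 1
  funext i
  by_cases hi : i = z
  · subst hi
    simp [ext_z]
  · simp [ext, hi]

theorem typeII_of_covBy {ρ : Set (Fin 2 → A)} {σ : Set (Fin 1 → A)} (hρ : IsCentral ρ)
    (hσ : IsCentral σ) (hdisj : ¬ (center ρ ∩ unarySet σ).Nonempty)
    (hcov : Pol ({⟨2, ρ⟩, ⟨1, σ⟩} : Set (FinRel A)) ⋖ Pol ({⟨2, ρ⟩} : Set (FinRel A))) :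
    ρ = commonNeighbour ρ σ ∧
      ∀ B : Set A, Maximal (IsRelChain ρ) B → (B ∩ unarySet σ).Nonempty := by
  classical
  obtain ⟨c, hc⟩ := hρ.center_nonempty
  have hcσ : c ∉ unarySet σ := fun hcσ => hdisj ⟨c, hc, hcσ⟩
  obtain ⟨u₀, hu₀⟩ := hσ.center_nonempty
  rw [center_eq_unarySet] at hu₀
  have hcadj : ∀ a, ![c, a] ∈ ρ := fun a => hρ.mem_of_center hc 0 rfl
  have main : ∀ {ι : Type} [Finite ι] (y : ι → A),
      (∀ q : Fin 2 → ι, Injective q → (fun m => y (q m)) ∈ ρ ∨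
        ∃ t : ι → A, (∃ u ∈ unarySet σ, ∀ i, ![t i, u] ∈ ρ) ∧ (fun m => t (q m)) ∉ ρ) →
      ∃ u ∈ unarySet σ, ∀ i, ![y i, u] ∈ ρ := by
    intro ι _ y H
    refine mem_of_unary_covBy hρ hσ le_rfl hcσ hcov
      (R := {y | ∃ u ∈ unarySet σ, ∀ i, ![y i, u] ∈ ρ}) ?_ ?_ ?_ y H
    · intro n f hfρ hfσ x hx
      choose u hu hxu using hx
      exact ⟨f u, preservesOn_unary_iff.1 hfσ u hu,
        fun i => preservesOn_binary_iff.1 hfρ _ _ fun j => hxu j i⟩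
    · exact ⟨u₀, hu₀, fun i => hcadj _⟩
    · intro i j hij
      refine ⟨update (fun _ => c) i u₀, ⟨u₀, hu₀, fun l => ?_⟩, ?_⟩
      · by_cases hl : l = i
        · subst hl
          simpa using hρ.refl_two u₀
        · simpa [hl] using hcadj u₀
      · have : u₀ ≠ c := fun he => hcσ (he ▸ hu₀)
        simpa [hij.symm] using this
  refine ⟨Set.Subset.antisymm ?_ ?_, ?_⟩
  · intro x hx
    obtain ⟨u, hu, hxu⟩ := main x fun q _ => Or.inl (hρ.comp_mem hx q)
    exact ⟨u, hu, hxu 0, hxu 1⟩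
  · rintro x ⟨w, hw, hx0, hx1⟩
    by_contra hx
    -- A pair outside `ρ` with a common neighbour in `σ` defeats every obstruction, so one element
    -- of `σ` is adjacent to all of `A`.
    obtain ⟨u, hu, hall⟩ := main (fun a : A => a) fun q hq => by
      refine Or.inr ⟨fun i => if i = q 0 then x 0 else x 1, ⟨w, hw, fun i => ?_⟩, ?_⟩
      · dsimp only
        split_ifs
        exacts [hx0, hx1]
      · convert hx using 2
        funext m
        fin_cases m
        · simp
        · simp [hq.ne (show (1 : Fin 2) ≠ 0 by simp)]
    refine hdisj ⟨u, hρ.mem_center_of_update 1 fun y => ?_, hu⟩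
    rw [mem_fin_two_iff]
    simpa using hall (y 0)
  · intro B hB
    have hchain := isRelChain_two_iff.1 hB.prop
    obtain ⟨u, hu, hBu⟩ := main (fun b : B => b.1) fun q _ =>
      Or.inl (hB.prop _ fun i => (q i).2)
    refine ⟨u, ?_, hu⟩
    have hins : IsRelChain ρ (insert u B) := by
      rw [isRelChain_two_iff]
      rintro a (rfl | ha) b (rfl | hb)
      · exact hρ.refl_two _
      · exact hρ.symm_two (hBu ⟨b, hb⟩)
      · exact hBu ⟨a, ha⟩
      · exact hchain a ha b hb
    exact hB.le_of_ge hins (Set.subset_insert u B) (Set.mem_insert u B)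

end UnaryNecessity

/-! ### Both arities at least two: the centers meet and the relations are comparable -/

section CommonCenter

variable {A : Type} {h s : ℕ}

theorem update_map {N ι : Type} [DecidableEq ι] (f : (N → A) → A) (x : N → ι → A) (u : N → A)
    (i : ι) : update (fun m => f fun j => x j m) i (f u) =
      fun m => f fun j => update (x j) i (u j) m := by
  funext m
  by_cases hm : m = i
  · subst hm
    simp
  · simp [hm]

/-- The default `w z` keeps all values among the entries of `w`; a value indexed by `i ≠ z` also
identifies the argument. -/
theorem extend_rows_eq {σ : Set (Fin s → A)} (hσ : IsCentral σ) (w : Fin s → A) (z : Fin s)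
    (x : σ → A) : ∃ i, extend (rows σ) w (fun _ => w z) x = w i ∧ (i ≠ z → x = rows σ i) := by
  by_cases hx : ∃ i, rows σ i = x
  · obtain ⟨i, rfl⟩ := hx
    exact ⟨i, hσ.rows_injective.extend_apply w _ i, fun _ => rfl⟩
  · exact ⟨z, extend_apply' _ _ _ hx, fun hz => absurd rfl hz⟩

/-- The free coordinate `z` can repeat an entry, which puts the tuple into `σ` whatever is
prescribed along `q`. -/
theorem IsCentral.exists_mem_notMem_of_missing {ρ : Set (Fin h → A)} {σ : Set (Fin s → A)}
    (hρ : IsCentral ρ) (hσ : IsCentral σ) {q : Fin h → Fin s} (hq : Injective q) {z : Fin s}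
    (hz : ∀ m, q m ≠ z) : ∃ t ∈ σ, (fun m => t (q m)) ∉ ρ := by
  obtain ⟨v, hv⟩ := hρ.exists_notMem
  let m₁ : Fin h := ⟨0, hρ.arity_pos⟩
  refine ⟨extend q v fun _ => v m₁, hσ.totallyReflexive _ ⟨z, q m₁, (hz m₁).symm, ?_⟩, ?_⟩
  · rw [hq.extend_apply, extend_apply' _ _ _ fun ⟨m, hm⟩ => hz m hm]
  · simpa [hq.extend_apply] using hv

theorem preservesOn_extend_rows {ρ : Set (Fin h → A)} {σ : Set (Fin s → A)}
    (hρ : IsCentral ρ) (hσ : IsCentral σ) {w : Fin s → A} {z : Fin s} (hz : w z ∈ center ρ) :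
    PreservesOn (extend (rows σ) w fun _ => w z) ρ := by
  refine hρ.preservesOn_extend hz hσ.rows_injective w fun q hq hcol => ?_
  by_cases hm : ∃ m, q m = z
  · obtain ⟨m, hm⟩ := hm
    exact hρ.mem_of_center hz m (congrArg w hm)
  · push Not at hm
    obtain ⟨t, ht, htq⟩ := hρ.exists_mem_notMem_of_missing hσ hq hm
    exact absurd (hcol ⟨t, ht⟩) htq

theorem IsCentral.nonempty {σ : Set (Fin s → A)} (hσ : IsCentral σ) : σ.Nonempty := by
  obtain ⟨d, hd⟩ := hσ.center_nonempty
  exact ⟨fun _ => d, hσ.mem_of_center hd ⟨0, hσ.arity_pos⟩ rfl⟩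

/-- Pairs of families such that some `u` completes every selection from the first family to a tuple
of `ρ` and every selection from the second one to a tuple of `σ`. -/
def jointRel (ρ : Set (Fin h → A)) (σ : Set (Fin s → A)) (i₀ : Fin h) (j₀ : Fin s)
    (I I' : Type) : Set (I ⊕ I' → A) :=
  {γ | ∃ u, (∀ a : Fin h → I, update (fun m => γ (Sum.inl (a m))) i₀ u ∈ ρ) ∧
    ∀ b : Fin s → I', update (fun m => γ (Sum.inr (b m))) j₀ u ∈ σ}

theorem preservesOn_jointRel {ρ : Set (Fin h → A)} {σ : Set (Fin s → A)} (i₀ : Fin h) (j₀ : Fin s)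
    (I I' : Type) {N : Type} (f : (N → A) → A) (hfρ : PreservesOn f ρ) (hfσ : PreservesOn f σ) :
    PreservesOn f (jointRel ρ σ i₀ j₀ I I') := by
  intro γ hγ
  choose u huρ huσ using hγ
  refine ⟨f u, fun a => ?_, fun b => ?_⟩
  · rw [update_map f (fun j m => γ j (Sum.inl (a m)))]
    exact hfρ _ fun j => huρ j a
  · rw [update_map f (fun j m => γ j (Sum.inr (b m)))]
    exact hfσ _ fun j => huσ j b

theorem exists_ne_of_two_le {n : ℕ} (hn : 2 ≤ n) (i : Fin n) : ∃ j, j ≠ i := by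
  have : Nontrivial (Fin n) := Fin.nontrivial_iff_two_le.2 hn
  exact _root_.exists_ne i

variable [Finite A]

theorem preserved_of_extend_rows {ρ : Set (Fin h → A)} {σ : Set (Fin s → A)}
    (hρ : IsCentral ρ) (hσ : IsCentral σ)
    (hcov : Pol ({⟨h, ρ⟩, ⟨s, σ⟩} : Set (FinRel A)) ⋖ Pol ({⟨h, ρ⟩} : Set (FinRel A)))
    {w : Fin s → A} (hw : w ∉ σ) {z : Fin s} (hz : w z ∈ center ρ) {ι : Type} {R : Set (ι → A)}
    (hR : ∀ n (f : (Fin n → A) → A), PreservesOn f ρ → PreservesOn f σ → PreservesOn f R)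
    (hfR : PreservesOn (extend (rows σ) w fun _ => w z) R)
    (N : Type) [Finite N] [Nonempty N] (f : (N → A) → A) (hf : PreservesOn f ρ) :
    PreservesOn f R := by
  have : Nonempty σ := hσ.nonempty.to_subtype
  rcases preserved_or_of_covBy hcov hR with h1 | h1
  · exact h1 N f hf
  · exact absurd (h1 σ _ (preservesOn_extend_rows hρ hσ hz) hfR)
      (not_preservesOn_extend_rows hσ hw _)

/-- No injective choice of coordinates obstructs: `u = c` works when the second family is constantly
`c`, and `u = d` when the chosen coordinates are not all in the first family. -/
theorem mem_jointRel_of_preserved {ρ : Set (Fin h → A)} {σ : Set (Fin s → A)}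
    (hρ : IsCentral ρ) (hσ : IsCentral σ) (hh : 2 ≤ h) (hs : 2 ≤ s)
    {d : A} (hd : d ∈ center σ) (hdρ : d ∉ center ρ) {i₀ : Fin h} {j₀ : Fin s}
    {I I' : Type} [Finite I] [Finite I']
    (hD : ∀ (N : Type) [Finite N] [Nonempty N] (f : (N → A) → A),
      PreservesOn f ρ → PreservesOn f (jointRel ρ σ i₀ j₀ I I')) (γ : I ⊕ I' → A) :
    γ ∈ jointRel ρ σ i₀ j₀ I I' := by
  classical
  obtain ⟨c, hc⟩ := hρ.center_nonempty
  obtain ⟨a₀, ha₀⟩ := hρ.exists_ne c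
  obtain ⟨i₁, hi₁⟩ := exists_ne_of_two_le hh i₀
  obtain ⟨j₁, hj₁⟩ := exists_ne_of_two_le hs j₀
  have memc : ∀ γ : I ⊕ I' → A, (∀ i', γ (Sum.inr i') = c) → γ ∈ jointRel ρ σ i₀ j₀ I I' := by
    intro γ hγ
    refine ⟨c, fun a => hρ.update_mem_of_center hc _ _, fun b => ?_⟩
    exact hσ.totallyReflexive _ ⟨j₁, j₀, hj₁, by simp [hj₁, hγ]⟩
  have memd : ∀ γ : I ⊕ I' → A, (∀ i, γ (Sum.inl i) = c) → γ ∈ jointRel ρ σ i₀ j₀ I I' := by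
    intro γ hγ
    refine ⟨d, fun a => ?_, fun b => hσ.update_mem_of_center hd _ _⟩
    exact hρ.mem_of_center hc i₁ (by simp [hi₁, hγ])
  have : Nonempty (jointRel ρ σ i₀ j₀ I I') := ⟨⟨fun _ => c, memc _ fun _ => rfl⟩⟩
  refine hρ.mem_of_preserved (hD _) (fun p p' hpp => ?_) γ fun q hq => Or.inr ?_
  · refine ⟨update (fun _ => c) p a₀, ?_, by simpa [hpp.symm] using ha₀⟩
    rcases p with i | i'
    · exact memc _ fun _ => by simp
    · exact memd _ fun _ => by simp
  · by_cases hleft : ∀ m, ∃ i, q m = Sum.inl i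
    · obtain ⟨v, hv⟩ := hρ.exists_notMem
      refine ⟨extend q v fun _ => c, memc _ fun i' => extend_apply' _ _ _ ?_, ?_⟩
      · rintro ⟨m, hm⟩
        obtain ⟨i, hi⟩ := hleft m
        simp [hi] at hm
      · simpa [hq.extend_apply] using hv
    · push Not at hleft
      obtain ⟨m₀, hm₀⟩ := hleft
      obtain ⟨m₁, hm₁⟩ := exists_ne_of_two_le hh m₀
      -- The entry `d` of `w` sits at `m₁ ≠ m₀`. A selection from the first family never uses `m₀`,
      -- so completing it by `d` gives an entry `c` or a rearrangement of `update w m₀ d`, where `d`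
      -- occurs twice.
      obtain ⟨w, hw, hwd⟩ := hρ.exists_notMem_of_notMem_center hdρ m₁
      refine ⟨extend q w fun _ => c, ⟨d, fun a => ?_, fun b => hσ.update_mem_of_center hd _ _⟩,
        by simpa [hq.extend_apply] using hw⟩
      by_cases hall : ∀ i, i ≠ i₀ → ∃ m, q m = Sum.inl (a i)
      · choose r hr using hall
        have hbase : update w m₀ d ∈ ρ :=
          hρ.totallyReflexive _ ⟨m₁, m₀, hm₁, by simp [hm₁, hwd]⟩
        convert hρ.comp_mem hbase fun i => if hi : i = i₀ then m₀ else r i hi using 1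
        funext i
        by_cases hi : i = i₀
        · subst hi
          simp
        · have hne : r i hi ≠ m₀ := fun he => hm₀ (a i) (he ▸ hr i hi)
          simp [hi, hne, ← hr i hi, hq.extend_apply]
      · push Not at hall
        obtain ⟨i, hi, hia⟩ := hall
        refine hρ.mem_of_center hc i ?_
        rw [update_of_ne hi]
        exact extend_apply' _ _ _ fun ⟨m, hm⟩ => hia m hm

/-- The operation built from `w` takes only entries of `w` as values, so `d` always witnesses
`jointRel`. That relation is then full, and listing `A` in both families yields a common central
element. -/
theorem not_common_center {ρ : Set (Fin h → A)} {σ : Set (Fin s → A)}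
    (hρ : IsCentral ρ) (hσ : IsCentral σ) (hh : 2 ≤ h) (hs : 2 ≤ s)
    (hcov : Pol ({⟨h, ρ⟩, ⟨s, σ⟩} : Set (FinRel A)) ⋖ Pol ({⟨h, ρ⟩} : Set (FinRel A)))
    (hdisj : ¬ (center ρ ∩ center σ).Nonempty)
    {w : Fin s → A} (hw : w ∉ σ) {z : Fin s} (hz : w z ∈ center ρ) (i₀ : Fin h) (j₀ : Fin s) (d : A)
    (hdρ : ∀ a : Fin h → Fin s, update (fun m => w (a m)) i₀ d ∈ ρ)
    (hdσ : ∀ b : Fin s → Fin s, update (fun m => w (b m)) j₀ d ∈ σ) : False := by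
  obtain ⟨e, he⟩ := hσ.center_nonempty
  have heρ : e ∉ center ρ := fun heρ => hdisj ⟨e, heρ, he⟩
  obtain ⟨u, hu₁, hu₂⟩ := mem_jointRel_of_preserved hρ hσ hh hs he heρ
    (preserved_of_extend_rows hρ hσ hcov hw hz
      (fun n f => preservesOn_jointRel i₀ j₀ A A f) (by
        intro γ _
        choose r hr using fun p => extend_rows_eq hσ w z fun t => γ t p
        refine ⟨d, fun a => ?_, fun b => ?_⟩
        · simpa only [hr] using hdρ fun m => r (Sum.inl (a m))
        · simpa only [hr] using hdσ fun m => r (Sum.inr (b m))))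
    (Sum.elim id id)
  exact hdisj ⟨u, hρ.mem_center_of_update i₀ hu₁, hσ.mem_center_of_update j₀ hu₂⟩

theorem mem_of_two_central {ρ : Set (Fin h → A)} {σ : Set (Fin s → A)}
    (hρ : IsCentral ρ) (hσ : IsCentral σ) (hh : 2 ≤ h) (hs : 2 ≤ s)
    (hcov : Pol ({⟨h, ρ⟩, ⟨s, σ⟩} : Set (FinRel A)) ⋖ Pol ({⟨h, ρ⟩} : Set (FinRel A)))
    (hdisj : ¬ (center ρ ∩ center σ).Nonempty)
    {w : Fin s → A} {z z' : Fin s} (hzz : z ≠ z') (hz : w z ∈ center ρ) (hz' : w z' ∈ center ρ) :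
    w ∈ σ := by
  classical
  by_contra hw
  rcases le_or_gt s h with hsh | hsh
  · obtain ⟨e, he⟩ := hσ.center_nonempty
    refine not_common_center hρ hσ hh hs hcov hdisj hw hz ⟨0, hρ.arity_pos⟩ z e (fun a => ?_)
      fun b => hσ.update_mem_of_center he _ _
    generalize (⟨0, hρ.arity_pos⟩ : Fin h) = i₀
    by_cases hhit : ∃ i, i ≠ i₀ ∧ (a i = z ∨ a i = z')
    · obtain ⟨i, hi, hai⟩ := hhit
      have hcen : w (a i) ∈ center ρ := by
        rcases hai with hai | hai <;> simpa [hai]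
      exact hρ.mem_of_center hcen i (by simp [hi])
    · push Not at hhit
      -- As `s - 2 < h - 1`, a selection avoiding `z` and `z'` repeats an entry.
      have hcard : ((Finset.univ.erase z).erase z').card < (Finset.univ.erase i₀).card := by
        rw [Finset.card_erase_of_mem (by simp [hzz.symm]), Finset.card_erase_of_mem (by simp),
          Finset.card_erase_of_mem (by simp)]
        simp only [Finset.card_univ, Fintype.card_fin]
        omega
      obtain ⟨i, hi, j, hj, hij, haij⟩ :=
        Finset.exists_ne_map_eq_of_card_lt_of_maps_to hcard (f := a) (by
          intro i hi
          have := hhit i (by simpa using hi)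
          simp [this.1, this.2])
      have hi' : i ≠ i₀ := by simpa using hi
      have hj' : j ≠ i₀ := by simpa using hj
      exact hρ.totallyReflexive _ ⟨i, j, hij, by simp [hi', hj', haij]⟩
  · let R : Set (Fin s → A) := {a | a ∈ σ ∧ ∀ q : Fin h → Fin s, Injective q →
      (∃ m, q m = z ∨ q m = z') → (fun m => a (q m)) ∈ ρ}
    have hcz : ∀ i, i = z ∨ i = z' → w i ∈ center ρ := by
      rintro i (rfl | rfl)
      exacts [hz, hz']
    have hfR : PreservesOn (extend (rows σ) w fun _ => w z) R := by
      intro a ha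
      refine ⟨?_, fun q hq hm =>
        preservesOn_extend_rows hρ hσ hz (fun j m => a j (q m)) fun j => (ha j).2 q hq hm⟩
      by_contra hbad
      choose r hr hrz using fun p => extend_rows_eq hσ w z fun t => a t p
      simp only [hr] at hbad
      have hrinj : Injective r := fun i j hij =>
        hσ.injective_of_notMem hbad (congrArg w hij)
      obtain ⟨p, hp⟩ := (Finite.injective_iff_surjective.1 hrinj) z
      -- Two marked positions are needed here: one survives the removal of `p`. The `h` coordinates
      -- `T` through it avoid `p`, so `R` forces the corresponding rows of `σ` into `ρ`, although
      -- they miss row `z`.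
      obtain ⟨e, hep, hez⟩ : ∃ e, e ≠ p ∧ (e = z ∨ e = z') := by
        by_cases hpz : z = p
        · exact ⟨z', hpz ▸ hzz.symm, Or.inr rfl⟩
        · exact ⟨z, hpz, Or.inl rfl⟩
      obtain ⟨T, hT₁, hT₂, hT⟩ := Finset.exists_subsuperset_card_eq
        (s := {e}) (t := Finset.univ.erase p) (n := h) (by simpa using hep) (by simpa using hρ.arity_pos)
        (by rw [Finset.card_erase_of_mem (by simp), Finset.card_univ, Fintype.card_fin]; omega)
      let q := T.orderEmbOfFin hT
      have hqp : ∀ m, q m ≠ p := fun m => by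
        simpa using hT₂ (T.orderEmbOfFin_mem hT m)
      have heq : ∃ m, q m = e := by
        have : e ∈ Set.range q := by
          rw [Finset.range_orderEmbOfFin]
          exact hT₁ (by simp)
        exact this
      obtain ⟨t, ht, htq⟩ := hρ.exists_mem_notMem_of_missing hσ (hrinj.comp q.injective)
        (z := z) fun m hm => hqp m (hrinj (hm.trans hp.symm))
      obtain ⟨m, hm⟩ := heq
      apply htq
      have hcol := (ha ⟨t, ht⟩).2 q q.injective ⟨m, by rwa [hm]⟩
      convert hcol using 1
      funext l
      have hne : r (q l) ≠ z := fun he => hqp l (hrinj (he.trans hp.symm))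
      exact (congrFun (hrz (q l) hne) ⟨t, ht⟩).symm
    have hD := preserved_of_extend_rows hρ hσ hcov hw hz (R := R) (fun n f hfρ hfσ a ha =>
      ⟨hfσ a fun j => (ha j).1, fun q hq hm =>
        hfρ (fun j m => a j (q m)) fun j => (ha j).2 q hq hm⟩) hfR
    obtain ⟨a₀, ha₀⟩ := hρ.exists_ne (w z)
    have hne : ∀ i, update (fun _ => w z) i a₀ ∈ R := by
      intro i
      constructor
      · obtain ⟨j, hj, k, hk, hjk⟩ := (Finset.one_lt_card (s := Finset.univ.erase i)).1 (by
          rw [Finset.card_erase_of_mem (by simp), Finset.card_univ, Fintype.card_fin]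
          omega)
        have hj' : j ≠ i := by simpa using hj
        have hk' : k ≠ i := by simpa using hk
        exact hσ.totallyReflexive _ ⟨j, k, hjk, by simp [hj', hk']⟩
      · intro q hq _
        obtain ⟨m, hm⟩ : ∃ m, q m ≠ i := by
          by_contra! hall
          exact (show (⟨0, by omega⟩ : Fin h) ≠ ⟨1, by omega⟩ by simp)
            (hq ((hall _).trans (hall _).symm))
        exact hρ.mem_of_center hz m (by simp [hm])
    have : Nonempty R := ⟨⟨_, hne z⟩⟩
    refine hw (hρ.mem_of_preserved (hD R) (fun i j hij => ⟨_, hne i, ?_⟩) w fun q hq => ?_).1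
    · simpa [hij.symm] using ha₀
    · by_cases hhit : ∃ m, q m = z ∨ q m = z'
      · obtain ⟨m, hm⟩ := hhit
        exact Or.inl (hρ.mem_of_center (hcz _ hm) m rfl)
      · push Not at hhit
        obtain ⟨v, hv⟩ := hρ.exists_notMem
        have hext : ∀ i, i = z ∨ i = z' → extend q v (fun _ => w z) i = w z := by
          intro i hi
          refine extend_apply' _ _ _ ?_
          rintro ⟨m, rfl⟩
          rcases hi with hi | hi
          exacts [(hhit m).1 hi, (hhit m).2 hi]
        refine Or.inr ⟨extend q v fun _ => w z, ⟨?_, ?_⟩, by simpa [hq.extend_apply] using hv⟩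
        · exact hσ.totallyReflexive _ ⟨z, z', hzz, by rw [hext z (Or.inl rfl), hext z' (Or.inr rfl)]⟩
        · rintro q' - ⟨m, hm⟩
          exact hρ.mem_of_center hz m (hext _ hm)

/-- If the centers are disjoint, a full `jointRel` with the entries of `w` other than `w z` as
second family gives a `u` central for `ρ` that fits those entries in `σ`. Together with
`mem_of_two_central`, this `u` meets the hypotheses of `not_common_center`. -/
theorem centers_meet_of_covBy {ρ : Set (Fin h → A)} {σ : Set (Fin s → A)}
    (hρ : IsCentral ρ) (hσ : IsCentral σ) (hh : 2 ≤ h) (hs : 2 ≤ s)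
    (hcov : Pol ({⟨h, ρ⟩, ⟨s, σ⟩} : Set (FinRel A)) ⋖ Pol ({⟨h, ρ⟩} : Set (FinRel A))) :
    (center ρ ∩ center σ).Nonempty := by
  classical
  by_contra hdisj
  obtain ⟨c, hc⟩ := hρ.center_nonempty
  obtain ⟨e, he⟩ := hσ.center_nonempty
  have heρ : e ∉ center ρ := fun heρ => hdisj ⟨e, heρ, he⟩
  have hcσ : c ∉ center σ := fun hcσ => hdisj ⟨c, hc, hcσ⟩
  let i₀ : Fin h := ⟨0, by omega⟩
  let z : Fin s := ⟨0, by omega⟩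
  obtain ⟨w, hw, hwz⟩ := hσ.exists_notMem_of_notMem_center hcσ z
  have hz : w z ∈ center ρ := hwz ▸ hc
  let I := {i : Fin s // i ≠ z}
  have hfR : PreservesOn (extend (rows σ) w fun _ => w z) (jointRel ρ σ i₀ z A I) := by
    intro γ hγ
    choose u huρ huσ using hγ
    choose r hr hrz using fun p => extend_rows_eq hσ w z fun t => γ t p
    simp only [hr]
    by_cases hall : ∀ b : Fin s → I, update (fun m => w (r (Sum.inr (b m)))) z (w z) ∈ σ
    · exact ⟨w z, fun a => hρ.update_mem_of_center hz _ _, hall⟩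
    · push Not at hall
      obtain ⟨b, hb⟩ := hall
      have hinj := hσ.injective_of_notMem hb
      have hbz : ∀ i, i ≠ z → r (Sum.inr (b i)) ≠ z := by
        intro i hi hri
        exact hi (hinj (by simp [hi, hri]))
      have hbinj : Injective fun i : I => b i.1 := by
        intro i j hij
        refine Subtype.ext (hinj ?_)
        simp only at hij
        simp [i.2, j.2, hij]
      have hrI : ∀ i : I, r (Sum.inr i) ≠ z := by
        intro i
        obtain ⟨j, rfl⟩ := (Finite.injective_iff_surjective.1 hbinj) i
        exact hbz j.1 j.2
      -- When `w z` fails as witness, the second family of values is a rearrangement of `w` off `z`.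
      -- The column `t` agrees with `w` there, so its own witness `u t` can be reused.
      let t : σ := ⟨update w z e, hσ.update_mem_of_center he _ _⟩
      have hcol : ∀ p, r p ≠ z → γ t p = w (r p) := by
        intro p hp
        have := congrFun (hrz p hp) t
        simpa [rows, t, hp] using this
      refine ⟨u t, fun a => ?_, fun b' => ?_⟩
      · by_cases hhit : ∃ i, i ≠ i₀ ∧ r (Sum.inl (a i)) = z
        · obtain ⟨i, hi, hri⟩ := hhit
          exact hρ.mem_of_center hz i (by simp [hi, hri])
        · push Not at hhit
          convert huρ t a using 1
          funext i
          by_cases hi : i = i₀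
          · subst hi
            simp
          · simp [hi, hcol _ (hhit i hi)]
      · convert huσ t b' using 2
        funext i
        exact (hcol _ (hrI _)).symm
  obtain ⟨u, huρ, huσ⟩ := mem_jointRel_of_preserved hρ hσ hh hs he heρ
    (preserved_of_extend_rows hρ hσ hcov hw hz (fun n f => preservesOn_jointRel i₀ z A I f) hfR)
    (Sum.elim id fun i => w i.1)
  have huc : u ∈ center ρ := hρ.mem_center_of_update i₀ huρ
  refine not_common_center hρ hσ hh hs hcov hdisj hw hz i₀ z u
    (fun a => hρ.update_mem_of_center huc _ _) fun b => ?_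
  by_cases hhit : ∃ i, i ≠ z ∧ b i = z
  · obtain ⟨i, hi, hbi⟩ := hhit
    exact mem_of_two_central hρ hσ hh hs hcov hdisj hi (by simpa [hi, hbi] using hz)
      (by simpa using huc)
  · push Not at hhit
    obtain ⟨j, hj⟩ := exists_ne_of_two_le hs z
    -- Only position `z` may need the filler `j`, and `update` overwrites it.
    convert huσ fun i => if hi : b i = z then ⟨j, hj⟩ else ⟨b i, hi⟩ using 1
    funext i
    by_cases hi : i = z
    · subst hi
      simp
    · simp [hi, hhit i hi]

theorem comparable_of_covBy {ρ : Set (Fin h → A)} {σ : Set (Fin s → A)}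
    (hρ : IsCentral ρ) (hσ : IsCentral σ) (hh : 2 ≤ h) (e : h ≤ s)
    (hcov : Pol ({⟨h, ρ⟩, ⟨s, σ⟩} : Set (FinRel A)) ⋖ Pol ({⟨h, ρ⟩} : Set (FinRel A))) :
    extendArity e ρ ⊆ σ ∨ σ ⊆ extendArity e ρ := by
  classical
  obtain ⟨c, hcρ, hcσ⟩ := centers_meet_of_covBy hρ hσ hh (hh.trans e) hcov
  by_contra! hnot
  obtain ⟨hnot₁, hnot₂⟩ := hnot
  obtain ⟨y, hy, hyσ⟩ := Set.not_subset.1 hnot₁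
  obtain ⟨t₀, ht₀σ, ht₀⟩ := Set.not_subset.1 hnot₂
  obtain ⟨a₀, ha₀⟩ := hρ.exists_ne c
  let R : Set (Fin s → A) := σ ∩ extendArity e ρ
  have hR : ∀ n (f : (Fin n → A) → A), PreservesOn f ρ → PreservesOn f σ → PreservesOn f R :=
    fun n f hfρ hfσ a ha => ⟨hfσ a fun j => (ha j).1,
      hfρ (fun j m => a j (Fin.castLE e m)) fun j => (ha j).2⟩
  have memR : ∀ (m : Fin h) (t : Fin s → A), t (Fin.castLE e m) = c → t ∈ R := fun m t ht =>
    ⟨hσ.mem_of_center hcσ _ ht, hρ.mem_of_center hcρ m ht⟩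
  have hsel : ∀ q : Fin h → Fin s, Injective q → ∃ t ∈ σ, (fun m => t (q m)) ∉ ρ := by
    intro q hq
    obtain ⟨π, hπ⟩ := exists_perm_castLE (e := e) hq
    refine ⟨fun i => t₀ (π i), hσ.comp_mem ht₀σ π, ?_⟩
    simp only [hπ]
    exact ht₀
  -- Invariance of `R` under `Pol ρ` would put `y` into `σ`. Otherwise, sending the rows of `σ` to a
  -- tuple outside `σ` preserves `ρ` and `R` but not `σ`: by `hsel`, no injective choice of `h` rows
  -- has all columns in `ρ`.
  rcases preserved_or_of_covBy hcov hR with h1 | h1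
  · let m₀ : Fin h := ⟨0, by omega⟩
    let m₁ : Fin h := ⟨1, by omega⟩
    have : Nonempty R := ⟨⟨_, memR m₀ (fun _ => c) rfl⟩⟩
    refine hyσ (hρ.mem_of_preserved (h1 R) (fun i j hij => ?_) y fun q hq => ?_).1
    · refine ⟨update (fun _ => c) i a₀, ?_, by simpa [hij.symm] using ha₀⟩
      by_cases hi : Fin.castLE e m₀ = i
      · refine memR m₁ _ ?_
        have : Fin.castLE e m₁ ≠ i := by
          rw [← hi]
          simp [m₀, m₁, Fin.ext_iff]
        simp [this]
      · exact memR m₀ _ (by simp [hi])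
    · by_cases hhit : ∀ m, ∃ l, q l = Fin.castLE e m
      · left
        choose r hr using hhit
        have hrinj : Injective r := fun i j hij =>
          Fin.castLE_injective e ((hr i).symm.trans ((congrArg q hij).trans (hr j)))
        let π := Equiv.ofBijective r (Finite.injective_iff_bijective.1 hrinj)
        convert hρ.comp_mem hy π.symm using 1
        funext m
        have : r (π.symm m) = m := π.apply_symm_apply m
        rw [← hr, this]
      · push Not at hhit
        obtain ⟨m, hm⟩ := hhit
        obtain ⟨v, hv⟩ := hρ.exists_notMem
        exact Or.inr ⟨extend q v fun _ => c, memR m _ (extend_apply' _ _ _ fun ⟨l, hl⟩ => hm l hl),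
          by simpa [hq.extend_apply] using hv⟩
  · obtain ⟨w, hw⟩ := hσ.exists_notMem
    have : Nonempty σ := hσ.nonempty.to_subtype
    have hfρ : PreservesOn (extend (rows σ) w fun _ => c) ρ := by
      refine hρ.preservesOn_extend hcρ hσ.rows_injective w fun q hq hcol => ?_
      obtain ⟨t, ht, htq⟩ := hsel q hq
      exact absurd (hcol ⟨t, ht⟩) htq
    refine not_preservesOn_extend_rows hσ hw c (h1 σ _ hfρ fun a ha => ⟨?_, ?_⟩)
    · by_cases hall : ∀ i, ∃ l, rows σ l = fun t => a t i
      · choose r hr using hall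
        by_cases hrinj : Injective r
        · obtain ⟨t, ht, htq⟩ := hsel (fun m => r (Fin.castLE e m))
            (hrinj.comp (Fin.castLE_injective e))
          refine absurd ?_ htq
          have hcol : (fun m => a ⟨t, ht⟩ (Fin.castLE e m)) ∈ ρ := (ha ⟨t, ht⟩).2
          convert hcol using 1
          funext m
          exact congrFun (hr (Fin.castLE e m)) ⟨t, ht⟩
        · simp only [Injective, not_forall] at hrinj
          obtain ⟨i, j, hij, hne⟩ := hrinj
          refine hσ.totallyReflexive _ ⟨i, j, hne, ?_⟩
          change extend _ _ _ (fun t => a t i) = extend _ _ _ fun t => a t j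
          rw [← hr i, ← hr j, hij]
      · push Not at hall
        obtain ⟨i, hi⟩ := hall
        exact hσ.mem_of_center hcσ i (extend_apply' _ _ _ fun ⟨l, hl⟩ => hi l hl)
    · exact hfρ (fun j m => a j (Fin.castLE e m)) fun j => (ha j).2

end CommonCenter

/-! ### Sufficiency for each relative size of the arities -/

section Strictness

variable {A : Type} {h s : ℕ}

theorem IsCentral.not_subset_extendArity {ρ : Set (Fin h → A)} {σ : Set (Fin s → A)}
    (hρ : IsCentral ρ) (hσ : IsCentral σ) (e : h < s) : ¬ σ ⊆ extendArity e.le ρ := by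
  intro hsub
  obtain ⟨t, ht, htq⟩ := hρ.exists_mem_notMem_of_missing hσ (Fin.castLE_injective e.le)
    (z := ⟨h, e⟩) fun m hm => by
      have := congrArg Fin.val hm
      simp only [Fin.val_castLE] at this
      omega
  exact htq (hsub ht)

variable [Finite A]

/-- With `s < h` there is no injective choice of `h` rows among `s`, so all conditions concerning
`ρ` are vacuous; `s = 1` is included. -/
theorem covBy_of_lt {ρ : Set (Fin h → A)} {σ : Set (Fin s → A)} (hρ : IsCentral ρ)
    (hσ : IsCentral σ) (e : s < h) (hmeet : (center ρ ∩ center σ).Nonempty) :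
    Pol ({⟨h, ρ⟩, ⟨s, σ⟩} : Set (FinRel A)) ⋖ Pol ({⟨h, ρ⟩} : Set (FinRel A)) := by
  obtain ⟨c, hcρ, hcσ⟩ := hmeet
  have hno : ∀ q : Fin h → Fin s, ¬ Function.Injective q := fun q hq => by
    have := Fintype.card_le_of_injective q hq
    simp only [Fintype.card_fin] at this
    omega
  obtain ⟨w, hw⟩ := hσ.exists_notMem
  exact covBy_of_common_center hρ hσ hcρ hcσ (Or.inl fun q hq => absurd hq (hno q))
    (exists_preservesOn_not hρ hσ hw fun q hq => absurd hq (hno q))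

theorem covBy_of_extendArity_ssubset {ρ : Set (Fin h → A)} {σ : Set (Fin s → A)} (hρ : IsCentral ρ)
    (hσ : IsCentral σ) (e : h ≤ s) (hsub : extendArity e ρ ⊂ σ) :
    Pol ({⟨h, ρ⟩, ⟨s, σ⟩} : Set (FinRel A)) ⋖ Pol ({⟨h, ρ⟩} : Set (FinRel A)) := by
  obtain ⟨c, hc⟩ := hρ.center_nonempty
  have hcσ : c ∈ center σ := by
    rintro x ⟨i, hi, hx⟩
    refine hsub.subset (hρ.mem_of_center hc ⟨0, hρ.arity_pos⟩ ?_)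
    rw [← hx]
    congr 1
    exact Fin.ext hi.symm
  obtain ⟨w, hw⟩ := hσ.exists_notMem
  obtain ⟨t₀, ht₀σ, ht₀⟩ := Set.exists_of_ssubset hsub
  refine covBy_of_common_center hρ hσ hc hcσ (Or.inr fun q hq t ht => ?_)
    (exists_preservesOn_not hρ hσ hw fun q hq => Or.inr ?_)
  · obtain ⟨π, hπ⟩ := exists_perm_castLE (e := e) hq
    have hmem : (fun i => t (π.symm i)) ∈ σ := by
      refine hsub.subset ?_
      have hπ' : ∀ m, π.symm (Fin.castLE e m) = q m := fun m => by
        rw [← hπ, Equiv.symm_apply_apply]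
      change (fun m => t (π.symm (Fin.castLE e m))) ∈ ρ
      simpa only [hπ'] using ht
    simpa using hσ.comp_mem hmem π
  · obtain ⟨π, hπ⟩ := exists_perm_castLE (e := e) hq
    refine ⟨fun i => t₀ (π i), hσ.comp_mem ht₀σ π, ?_⟩
    simp only [hπ]
    exact ht₀

theorem covBy_of_ssubset {ρ σ : Set (Fin h → A)} (hρ : IsCentral ρ) (hσ : IsCentral σ)
    (hsub : σ ⊂ ρ) :
    Pol ({⟨h, ρ⟩, ⟨h, σ⟩} : Set (FinRel A)) ⋖ Pol ({⟨h, ρ⟩} : Set (FinRel A)) := by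
  obtain ⟨c, hc⟩ := hσ.center_nonempty
  obtain ⟨w, hwρ, hw⟩ := Set.exists_of_ssubset hsub
  exact covBy_of_common_center hρ hσ (fun x hx => hsub.subset (hc x hx)) hc
    (Or.inl fun q _ t ht => hρ.comp_mem (hsub.subset ht) q)
    (exists_preservesOn_not hρ hσ hw fun q _ => Or.inl (hρ.comp_mem hwρ q))

end Strictness

end CloneTheory

theorem theorem1 (k : ℕ) (hk : 3 ≤ k) (h : ℕ) (hh : 2 ≤ h) (s : ℕ) (hs : 1 ≤ s)
    (ρ : Set (Fin h → Fin k)) (σ : Set (Fin s → Fin k))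
    (hρ : CloneTheory.IsCentral ρ) (hσ : CloneTheory.IsCentral σ)
    (hne : (⟨s, σ⟩ : CloneTheory.FinRel (Fin k)) ≠ ⟨h, ρ⟩) :
    CloneTheory.Pol ({⟨h, ρ⟩, ⟨s, σ⟩} : Set (CloneTheory.FinRel (Fin k))) ⋖
        CloneTheory.Pol ({⟨h, ρ⟩} : Set (CloneTheory.FinRel (Fin k))) ↔
      CloneTheory.TypeI ρ σ ∨ CloneTheory.TypeII ρ σ ∨ CloneTheory.TypeIII ρ σ ∨
        CloneTheory.TypeIV ρ σ ∨ CloneTheory.TypeV ρ σ := by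
  open CloneTheory in
  constructor
  · intro hcov
    rcases Nat.lt_or_ge s 2 with hs2 | hs2
    · obtain rfl : s = 1 := by omega
      by_cases hmeet : (center ρ ∩ unarySet σ).Nonempty
      · exact Or.inl ⟨rfl, hmeet⟩
      · rcases hh.eq_or_lt with rfl | hh3
        · exact Or.inr (Or.inl ⟨rfl, rfl, typeII_of_covBy hρ hσ hmeet hcov⟩)
        · exact absurd (typeI_of_covBy_of_three_le hρ hσ hh3 hcov) hmeet
    · rcases lt_trichotomy s h with hsh | rfl | hsh
      · exact Or.inr (Or.inr (Or.inr (Or.inl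
          ⟨hs2, hsh, centers_meet_of_covBy hρ hσ hh hs2 hcov⟩)))
      · have hneq : σ ≠ ρ := fun he => hne (he ▸ rfl)
        refine Or.inr (Or.inr (Or.inl ⟨rfl, ?_⟩))
        rcases comparable_of_covBy hρ hσ hh le_rfl hcov with hsub | hsub
        · exact Or.inl (LE.le.ssubset_of_ne hsub hneq.symm)
        · exact Or.inr (LE.le.ssubset_of_ne hsub hneq)
      · refine Or.inr (Or.inr (Or.inr (Or.inr ⟨hh, hsh, ?_⟩)))
        have hnot := hρ.not_subset_extendArity hσ hsh
        exact ⟨(comparable_of_covBy hρ hσ hh hsh.le hcov).resolve_right hnot, hnot⟩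
  · rintro (⟨rfl, hmeet⟩ | ⟨rfl, rfl, hcn, hmax⟩ | ⟨rfl, hsub | hsub⟩ | ⟨-, hsh, hmeet⟩ |
      ⟨-, e, hsub⟩)
    · refine covBy_of_lt hρ hσ (by omega) ?_
      rwa [center_eq_unarySet]
    · obtain ⟨w, hw⟩ := hσ.exists_notMem
      refine covBy_of_chains hρ hcn hmax (exists_preservesOn_not hρ hσ hw fun q hq => ?_)
      exact absurd (Fintype.card_le_of_injective q hq) (by simp)
    · exact covBy_of_extendArity_ssubset hρ hσ le_rfl hsub
    · exact covBy_of_ssubset hρ hσ hsub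
    · exact covBy_of_lt hρ hσ hsh hmeet
    · exact covBy_of_extendArity_ssubset hρ hσ e.le hsub
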